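/- Let $X$ be a compactum, that is, a compact Hausdorff space. The tightness $t(X)$ is the least infinite cardinal $\kappa$ such that whenever $A\subseteq X$ and $x\in\overline{A}$, there is $B\subseteq A$ with $|B|\le\kappa$ and $x\in\overline{B}$. For a cardinal $\lambda$ and $A\subseteq X$ put $\mathrm{cl}_\lambda A=\bigcup\{\overline{B}: B\subseteq A,\ |B|\le\lambda\}$. The weak tightness $wt(X)$ is the least infinite cardinal $\kappa$ for which $X$ has a cover $\mathcal{C}$ with $|\mathcal{C}|\le 2^\kappa$ such that every $C\in\mathcal{C}$ satisfies $t(C)\le\kappa$ (in the subspace topology) and $\mathrm{cl}_{2^\kappa}C=X$. The $\pi$-character $\pi_\chi(X)$ is the least infinite cardinal $\kappa$ such that every point $x\in X$ has a local $\pi$-base of size at most $\kappa$, that is, a family of at most $\kappa$ non-empty open sets such that every neighbourhood of $x$ includes a member of the family. The space $X$ is homogeneous if for all $x,y\in X$ there is a homeomorphism $h:X\to X$ with $h(x)=y$. If $X$ is a homogeneous compactum, then $$|X|\le 2^{wt(X)\cdot\pi_\chi(X)}.$$ Moreover, every compactum $X$ satisfies $wt(X)\le t(X)$ and $\pi_\chi(X)\le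 t(X)$; so the bound refines De la Vega's theorem that $|X|\le 2^{t(X)}$ for every homogeneous compactum $X$. -/

import Mathlib

open Cardinal Topology

universe u

namespace CardFun

/-- The `κ`-closure of `A`: the union of the closures of the subsets of `A` of size at most `κ`. -/
def kClosure {X : Type u} [TopologicalSpace X] (κ : Cardinal.{u}) (A : Set X) : Set X :=
  {x | ∃ B : Set X, B ⊆ A ∧ #B ≤ κ ∧ x ∈ closure B}

/-- The tightness `t(X)`: the least infinite cardinal `κ` such that whenever `x ∈ closure A`,
there is `B ⊆ A` with `|B| ≤ κ` and `x ∈ closure B`. -/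
noncomputable def tightness (X : Type u) [TopologicalSpace X] : Cardinal.{u} :=
  sInf {κ : Cardinal.{u} | ℵ₀ ≤ κ ∧ ∀ (A : Set X) (x : X), x ∈ closure A →
    ∃ B : Set X, B ⊆ A ∧ #B ≤ κ ∧ x ∈ closure B}

/-- The weak tightness `wt(X)`: the least infinite cardinal `κ` for which `X` has a cover `𝒞` with
`|𝒞| ≤ 2 ^ κ` such that each `C ∈ 𝒞`, as a subspace, has tightness at most `κ`, and the
`2 ^ κ`-closure of `C` in `X` is all of `X`. -/
noncomputable def weakTightness (X : Type u) [TopologicalSpace X] : Cardinal.{u} :=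
  sInf {κ : Cardinal.{u} | ℵ₀ ≤ κ ∧ ∃ 𝒞 : Set (Set X), ⋃₀ 𝒞 = Set.univ ∧
    #𝒞 ≤ 2 ^ κ ∧ ∀ C ∈ 𝒞, tightness C ≤ κ ∧ kClosure (2 ^ κ) C = Set.univ}

/-- A local `π`-base at `x`: a family of non-empty open sets (which need not contain `x`) such that
every neighbourhood of `x` includes a member of the family. -/
def IsLocalPiBase {X : Type u} [TopologicalSpace X] (x : X) (𝓑 : Set (Set X)) : Prop :=
  (∀ V ∈ 𝓑, IsOpen V ∧ V.Nonempty) ∧ ∀ U ∈ 𝓝 x, ∃ V ∈ 𝓑, V ⊆ U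

/-- The `π`-character `π_χ(X)`: the least infinite cardinal `κ` such that every point of `X` has a
local `π`-base of size at most `κ`. -/
noncomputable def piCharacter (X : Type u) [TopologicalSpace X] : Cardinal.{u} :=
  sInf {κ : Cardinal.{u} | ℵ₀ ≤ κ ∧ ∀ x : X, ∃ 𝓑 : Set (Set X), IsLocalPiBase x 𝓑 ∧ #𝓑 ≤ κ}

/-- A space is homogeneous if any point can be carried to any other one by a homeomorphism of the
space onto itself. -/
def IsHomogeneous (X : Type u) [TopologicalSpace X] : Prop :=
  ∀ x y : X, ∃ h : X ≃ₜ X, h x = y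

end CardFun

namespace CardFun

/-! Let `𝒞` witness `wt(X) ≤ κ`, and call `A` saturated if every member of `𝒞` traces a dense subset
on `A`. A point of `closure A` lies in some `C ∈ 𝒞` and in the closure of `C ∩ A`, so the tightness
of `C` reaches it from at most `κ` points of `A`. Saturated sets thus behave as in a space of
tightness `κ`, and any set of size `2 ^ κ` extends to a saturated one of that size. This has two
consequences: some non-empty `G_κ`-set lies in the closure of `2 ^ κ` points, as a free sequence of
length `κ⁺` would arise otherwise (`exists_zeroSet_subset_closure`); and `2 ^ κ` of any prescribed
`G_κ`-sets around the points cover `X` (`exists_subcover`). Homogeneity copies the first `G_κ`-set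
around every point, so `X` has a dense set of size `2 ^ κ` (`exists_dense`). Moving one local
`π`-base around then codes each point by a function from the base to the dense set
(`card_le_of_dense`). For `π_χ ≤ t`, a point without a small local `π`-base yields a free sequence
of length `t⁺`. -/

/-! ### Cardinal arithmetic, closing off and transfinite choice -/

theorem exists_range_eq {α : Type u} {κ : Cardinal.{u}} {S : Set α} (hS : #S ≤ κ)
    (hne : S.Nonempty) {K : Type u} (hK : #K = κ) : ∃ f : K → α, Set.range f = S := by
  subst hK
  obtain ⟨e⟩ := hS
  have : Nonempty S := hne.to_subtype
  refine ⟨fun k => (Function.invFun e k : S), ?_⟩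
  ext x
  constructor
  · rintro ⟨k, rfl⟩
    exact Subtype.property _
  · intro hx
    exact ⟨e ⟨x, hx⟩, by
      exact congrArg Subtype.val (Function.leftInverse_invFun e.injective ⟨x, hx⟩)⟩

theorem mk_biUnion_le_of_le {ι α : Type u} {c : Cardinal.{u}} (hc : ℵ₀ ≤ c) {s : Set ι}
    (hs : #s ≤ c) {A : ι → Set α} (hA : ∀ i ∈ s, #(A i) ≤ c) : #(⋃ i ∈ s, A i : Set α) ≤ c := by
  refine (mk_biUnion_le A s).trans (mul_le_of_le hc hs (ciSup_le' fun i => hA i i.2))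

theorem mk_union_le_of_le {α : Type u} {c : Cardinal.{u}} (hc : ℵ₀ ≤ c) {s t : Set α}
    (hs : #s ≤ c) (ht : #t ≤ c) : #(s ∪ t : Set α) ≤ c :=
  (mk_union_le s t).trans (add_le_of_le hc hs ht)

theorem mk_finset_le_of_le {α : Type u} {c : Cardinal.{u}} (hc : ℵ₀ ≤ c) (h : #α ≤ c) :
    #(Finset α) ≤ c := by
  rcases finite_or_infinite α with hα | hα
  · exact (lt_aleph0_of_finite _).le.trans hc
  · rwa [mk_finset_of_infinite]

theorem aleph0_le_two_power {κ : Cardinal.{u}} (hκ : ℵ₀ ≤ κ) : ℵ₀ ≤ 2 ^ κ :=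
  hκ.trans (cantor κ).le

theorem two_power_power {κ : Cardinal.{u}} (hκ : ℵ₀ ≤ κ) : ((2 : Cardinal.{u}) ^ κ) ^ κ = 2 ^ κ := by
  rw [← power_mul, mul_eq_self hκ]

/-- Any set of size at most `2 ^ κ` can be closed off under set-valued operations on subsets of size
at most `κ` without exceeding the size `2 ^ κ`. -/
theorem exists_closed_superset {X : Type u} {κ : Cardinal.{u}} (hκ : ℵ₀ ≤ κ) {A₀ : Set X}
    (hA₀ : #A₀ ≤ 2 ^ κ) (F : Set X → Set X) (hF : ∀ B : Set X, #B ≤ κ → #(F B) ≤ 2 ^ κ) :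
    ∃ A : Set X, A₀ ⊆ A ∧ #A ≤ 2 ^ κ ∧ ∀ B ⊆ A, #B ≤ κ → F B ⊆ A := by
  classical
  have h2 := aleph0_le_two_power hκ
  let K : Type u := κ.out
  have hK : #K = κ := mk_out κ
  have hKne : Nonempty K := by
    rw [← mk_ne_zero_iff, hK]
    exact (aleph0_pos.trans_le hκ).ne'
  let k₀ : K := hKne.some
  have hT : #(Set K) = 2 ^ κ := by rw [mk_set, hK]
  have hop : ∀ f : K → X, ∃ g : Set K → X, (F (Set.range f)).Nonempty →
      Set.range g = F (Set.range f) := by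
    intro f
    by_cases h : (F (Set.range f)).Nonempty
    · obtain ⟨g, hg⟩ := exists_range_eq (hF _ (mk_range_le.trans hK.le)) h hT
      exact ⟨g, fun _ => hg⟩
    · exact ⟨fun _ => f k₀, fun h' => (h h').elim⟩
  choose op hop using hop
  -- Terms over constants from `A₀` and `K`-ary operations enumerating `F`. The members of `F ∅`
  -- need constants of their own, since `∅` is not the range of a function on `K`.
  let β : A₀ ⊕ Set K ⊕ F ∅ → Type u :=
    Sum.elim (fun _ => PEmpty) (Sum.elim (fun _ => K) (fun _ => PEmpty))
  let ev : WType β → X := WType.elim X fun p => match p with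
    | ⟨Sum.inl a, _⟩ => a
    | ⟨Sum.inr (Sum.inl t), f⟩ => op f t
    | ⟨Sum.inr (Sum.inr a), _⟩ => a
  have hcard : #(WType β) ≤ 2 ^ κ := by
    refine WType.cardinalMk_le_of_le ((sum_le_mk_mul_iSup _).trans (mul_le_of_le h2 ?_ ?_))
    · simp only [mk_sum, lift_id]
      exact add_le_of_le h2 hA₀ (add_le_of_le h2 hT.le (hF _ (by simp)))
    · refine ciSup_le' ?_
      have h1 : (1 : Cardinal.{u}) ≤ 2 ^ κ := one_le_aleph0.trans h2
      rintro (a | t | a)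
      · simpa [β] using h1
      · simp only [β, Sum.elim_inr, Sum.elim_inl, hK, two_power_power hκ, le_refl]
      · simpa [β] using h1
  refine ⟨Set.range ev, fun a ha => ⟨WType.mk (Sum.inl ⟨a, ha⟩) PEmpty.elim, rfl⟩,
    mk_range_le.trans hcard, fun B hB hBκ x hx => ?_⟩
  rcases B.eq_empty_or_nonempty with rfl | hne
  · exact ⟨WType.mk (Sum.inr (Sum.inr ⟨x, hx⟩)) PEmpty.elim, rfl⟩
  · obtain ⟨f, rfl⟩ := exists_range_eq hBκ hne hK
    choose w hw using fun k => hB (Set.mem_range_self (f := f) k)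
    rw [← hop f ⟨x, hx⟩] at hx
    obtain ⟨t, rfl⟩ := hx
    refine ⟨WType.mk (Sum.inr (Sum.inl t)) w, ?_⟩
    change op (fun k => ev (w k)) t = op f t
    simp only [hw]

/-- Transfinite dependent choice along a well-order. -/
theorem exists_forall_of_wellFounded {I α : Type*} [LinearOrder I] [WellFoundedLT I] [Nonempty α]
    (R : (i : I) → (Set.Iio i → α) → α → Prop)
    (h : ∀ (i : I) (f : I → α), (∀ j < i, R j (fun k => f k) (f j)) →
      ∃ a, R i (fun k => f k) a) :
    ∃ f : I → α, ∀ i, R i (fun k => f k) (f i) := by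
  classical
  let f : I → α := (wellFounded_lt (α := I)).fix fun i g =>
    Classical.epsilon fun a => R i (fun k => g k k.2) a
  have hf : ∀ i, f i = Classical.epsilon fun a => R i (fun k => f k) a := fun i =>
    WellFounded.fix_eq _ _ i
  refine ⟨f, fun i => ?_⟩
  induction i using (wellFounded_lt (α := I)).induction with
  | _ i ih =>
    rw [hf i]
    exact Classical.epsilon_spec (h i f ih)

/-- A well-order of type `κ⁺`, described by its two properties that matter here. -/
theorem exists_wellOrder_succ {κ : Cardinal.{u}} (hκ : ℵ₀ ≤ κ) :
    ∃ (I : Type u) (_ : LinearOrder I), WellFoundedLT I ∧ (∀ i : I, #(Set.Iio i) ≤ κ) ∧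
      ∀ S : Set I, #S ≤ κ → ∃ i, ∀ s ∈ S, s < i := by
  refine ⟨(Order.succ κ).ord.ToType, inferInstance, inferInstance, ?_, ?_⟩
  · intro i
    exact Order.lt_succ_iff.1 (by simpa using mk_Iio_lt i (by simp))
  · intro S hS
    by_contra! hne
    have huniv : (⋃ s ∈ S, Set.Iic s) = (Set.univ : Set (Order.succ κ).ord.ToType) := by
      ext i
      simpa using hne i
    have h1 : #(⋃ s ∈ S, Set.Iic s : Set (Order.succ κ).ord.ToType) ≤ κ := by
      refine mk_biUnion_le_of_le hκ hS fun s _ => ?_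
      rw [← Set.Iio_union_right]
      refine mk_union_le_of_le hκ (Order.lt_succ_iff.1 (by simpa using mk_Iio_lt s (by simp))) ?_
      rw [mk_singleton]
      exact one_le_aleph0.trans hκ
    rw [huniv, mk_univ, mk_ord_toType] at h1
    exact (Order.lt_succ κ).not_ge h1

section

variable {X : Type u} [TopologicalSpace X] {κ : Cardinal.{u}}

/-! ### Attained infima and tightness of subspaces -/

theorem tightness_mem (X : Type u) [TopologicalSpace X] :
    ℵ₀ ≤ tightness X ∧ ∀ (A : Set X) (x : X), x ∈ closure A →
      ∃ B : Set X, B ⊆ A ∧ #B ≤ tightness X ∧ x ∈ closure B :=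
  csInf_mem (s := {κ : Cardinal.{u} | ℵ₀ ≤ κ ∧ ∀ (A : Set X) (x : X), x ∈ closure A →
    ∃ B : Set X, B ⊆ A ∧ #B ≤ κ ∧ x ∈ closure B})
    ⟨max ℵ₀ #X, le_max_left _ _, fun A _ hx =>
      ⟨A, subset_rfl, (mk_set_le A).trans (le_max_right _ _), hx⟩⟩

theorem tightness_le {κ : Cardinal.{u}} (hκ : ℵ₀ ≤ κ)
    (h : ∀ (A : Set X) (x : X), x ∈ closure A → ∃ B : Set X, B ⊆ A ∧ #B ≤ κ ∧ x ∈ closure B) :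
    tightness X ≤ κ :=
  csInf_le' ⟨hκ, h⟩

theorem exists_subset_of_tightness_le {C : Set X} (hC : tightness C ≤ κ) {A : Set X} (hA : A ⊆ C)
    {x : X} (hx : x ∈ C) (hxA : x ∈ closure A) : ∃ B ⊆ A, #B ≤ κ ∧ x ∈ closure B := by
  have h1 : (⟨x, hx⟩ : C) ∈ closure ((↑) ⁻¹' A : Set C) := by
    rw [closure_subtype, Subtype.image_preimage_coe, Set.inter_eq_right.2 hA]
    exact hxA
  obtain ⟨B, hBA, hB, hxB⟩ := (tightness_mem C).2 _ _ h1
  refine ⟨(↑) '' B, ?_, mk_image_le.trans (hB.trans hC), closure_subtype.1 hxB⟩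
  rintro _ ⟨b, hb, rfl⟩
  exact hBA hb

/-- The covers that witness that the weak tightness is at most `κ`. -/
structure IsWeakTightCover (κ : Cardinal.{u}) (𝒞 : Set (Set X)) : Prop where
  sUnion_eq : ⋃₀ 𝒞 = Set.univ
  card_le : #𝒞 ≤ 2 ^ κ
  tightness_le : ∀ C ∈ 𝒞, tightness C ≤ κ
  kClosure_eq : ∀ C ∈ 𝒞, kClosure (2 ^ κ) C = Set.univ

theorem tightness_univ_le : tightness (Set.univ : Set X) ≤ tightness X := by
  refine tightness_le (tightness_mem X).1 fun A x hx => ?_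
  obtain ⟨B, hBA, hB, hxB⟩ := (tightness_mem X).2 _ _ (closure_subtype.1 hx)
  refine ⟨(↑) ⁻¹' B, ?_, ?_, ?_⟩
  · rintro b hb
    obtain ⟨a, ha, hab⟩ := hBA hb
    rwa [← Subtype.ext hab]
  · exact (mk_preimage_of_injective _ _ Subtype.val_injective).trans hB
  · rw [closure_subtype, Subtype.image_preimage_coe, Set.univ_inter]
    exact hxB

theorem isWeakTightCover_singleton_univ (hκ : tightness X ≤ κ) :
    IsWeakTightCover κ {(Set.univ : Set X)} where
  sUnion_eq := Set.sUnion_singleton _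
  card_le := by
    rw [mk_singleton]
    exact one_le_aleph0.trans (aleph0_le_two_power ((tightness_mem X).1.trans hκ))
  tightness_le := by
    rintro _ rfl
    exact tightness_univ_le.trans hκ
  kClosure_eq := by
    rintro _ rfl
    refine Set.eq_univ_of_forall fun x => ⟨{x}, Set.subset_univ _, ?_, subset_closure rfl⟩
    rw [mk_singleton]
    exact one_le_aleph0.trans (aleph0_le_two_power ((tightness_mem X).1.trans hκ))

theorem weakTightness_le_tightness : weakTightness X ≤ tightness X := by
  have h := isWeakTightCover_singleton_univ (X := X) le_rfl
  exact csInf_le' ⟨(tightness_mem X).1, _, h.sUnion_eq, h.card_le,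
    fun C hC => ⟨h.tightness_le C hC, h.kClosure_eq C hC⟩⟩

theorem exists_isWeakTightCover (X : Type u) [TopologicalSpace X] :
    ℵ₀ ≤ weakTightness X ∧ ∃ 𝒞 : Set (Set X), IsWeakTightCover (weakTightness X) 𝒞 := by
  have h : weakTightness X ∈ {κ : Cardinal.{u} | ℵ₀ ≤ κ ∧ ∃ 𝒞 : Set (Set X), ⋃₀ 𝒞 = Set.univ ∧
      #𝒞 ≤ 2 ^ κ ∧ ∀ C ∈ 𝒞, tightness C ≤ κ ∧ kClosure (2 ^ κ) C = Set.univ} := by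
    refine csInf_mem ?_
    have h := isWeakTightCover_singleton_univ (X := X) le_rfl
    exact ⟨_, (tightness_mem X).1, _, h.sUnion_eq, h.card_le,
      fun C hC => ⟨h.tightness_le C hC, h.kClosure_eq C hC⟩⟩
  obtain ⟨h0, 𝒞, h1, h2, h3⟩ := h
  exact ⟨h0, 𝒞, h1, h2, fun C hC => (h3 C hC).1, fun C hC => (h3 C hC).2⟩

theorem IsWeakTightCover.mono {κ' : Cardinal.{u}} {𝒞 : Set (Set X)} (h : IsWeakTightCover κ 𝒞)
    (hκ : κ ≤ κ') : IsWeakTightCover κ' 𝒞 where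
  sUnion_eq := h.sUnion_eq
  card_le := h.card_le.trans (power_le_power_left two_ne_zero hκ)
  tightness_le C hC := (h.tightness_le C hC).trans hκ
  kClosure_eq C hC := Set.eq_univ_of_forall fun x => by
    obtain ⟨B, hBC, hB, hx⟩ : x ∈ kClosure (2 ^ κ) C := h.kClosure_eq C hC ▸ Set.mem_univ x
    exact ⟨B, hBC, hB.trans (power_le_power_left two_ne_zero hκ), hx⟩

theorem piCharacter_mem (X : Type u) [TopologicalSpace X] :
    ℵ₀ ≤ piCharacter X ∧
      ∀ x : X, ∃ 𝓑 : Set (Set X), IsLocalPiBase x 𝓑 ∧ #𝓑 ≤ piCharacter X := by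
  refine csInf_mem (s := {κ : Cardinal.{u} | ℵ₀ ≤ κ ∧
    ∀ x : X, ∃ 𝓑 : Set (Set X), IsLocalPiBase x 𝓑 ∧ #𝓑 ≤ κ})
    ⟨max ℵ₀ #(Set X), le_max_left _ _, fun x => ⟨{V | IsOpen V ∧ V.Nonempty}, ⟨fun V hV => hV, ?_⟩,
      (mk_set_le _).trans (le_max_right _ _)⟩⟩
  intro U hU
  obtain ⟨V, hVU, hV, hx⟩ := mem_nhds_iff.1 hU
  exact ⟨V, ⟨hV, x, hx⟩, hVU⟩

/-! ### Saturated sets -/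

/-- `A` is saturated for `𝒞` if every member of `𝒞` has a trace on `A` that is dense in `A`. -/
def IsSaturated (𝒞 : Set (Set X)) (A : Set X) : Prop :=
  ∀ C ∈ 𝒞, A ⊆ closure (C ∩ A)

theorem IsSaturated.iUnion {I : Type*} {𝒞 : Set (Set X)} {A : I → Set X}
    (h : ∀ i, IsSaturated 𝒞 (A i)) : IsSaturated 𝒞 (⋃ i, A i) := fun C hC =>
  Set.iUnion_subset fun i => (h i C hC).trans
    (closure_mono (Set.inter_subset_inter_right _ (Set.subset_iUnion A i)))

theorem IsWeakTightCover.exists_subset_of_mem_closure {𝒞 : Set (Set X)}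
    (h𝒞 : IsWeakTightCover κ 𝒞) {A : Set X} (hA : IsSaturated 𝒞 A) {z : X} (hz : z ∈ closure A) :
    ∃ B ⊆ A, #B ≤ κ ∧ z ∈ closure B := by
  obtain ⟨C, hC, hzC⟩ : z ∈ ⋃₀ 𝒞 := h𝒞.sUnion_eq ▸ Set.mem_univ z
  obtain ⟨B, hB, hBκ, hzB⟩ := exists_subset_of_tightness_le (h𝒞.tightness_le C hC)
    Set.inter_subset_left hzC (closure_minimal (hA C hC) isClosed_closure hz)
  exact ⟨B, hB.trans Set.inter_subset_right, hBκ, hzB⟩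

/-- `S x` collects, for each `C ∈ 𝒞`, at most `2 ^ κ` points of `C` with `x` in their closure.
Saturation thereby becomes a closure condition under a set-valued map, ready for closing off. -/
theorem IsWeakTightCover.exists_saturating {𝒞 : Set (Set X)} (hκ : ℵ₀ ≤ κ)
    (h𝒞 : IsWeakTightCover κ 𝒞) : ∃ S : X → Set X, (∀ x, #(S x) ≤ 2 ^ κ) ∧
      ∀ A : Set X, (∀ x ∈ A, S x ⊆ A) → IsSaturated 𝒞 A := by
  have h : ∀ (x : X) (C : Set X), ∃ B : Set X, C ∈ 𝒞 → B ⊆ C ∧ #B ≤ 2 ^ κ ∧ x ∈ closure B := by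
    intro x C
    by_cases hC : C ∈ 𝒞
    · obtain ⟨B, hB⟩ : x ∈ kClosure (2 ^ κ) C := h𝒞.kClosure_eq C hC ▸ Set.mem_univ x
      exact ⟨B, fun _ => hB⟩
    · exact ⟨∅, fun h => (hC h).elim⟩
  choose b hb using h
  refine ⟨fun x => ⋃ C ∈ 𝒞, b x C, fun x => mk_biUnion_le_of_le (aleph0_le_two_power hκ) h𝒞.card_le
    fun C hC => (hb x C hC).2.1, fun A hA C hC x hx => ?_⟩
  refine closure_mono ?_ (hb x C hC).2.2
  exact Set.subset_inter (hb x C hC).1 ((Set.subset_biUnion_of_mem hC).trans (hA x hx))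

theorem IsWeakTightCover.exists_isSaturated_superset {𝒞 : Set (Set X)} (hκ : ℵ₀ ≤ κ)
    (h𝒞 : IsWeakTightCover κ 𝒞) {A₀ : Set X} (hA₀ : #A₀ ≤ 2 ^ κ) :
    ∃ A, A₀ ⊆ A ∧ #A ≤ 2 ^ κ ∧ IsSaturated 𝒞 A := by
  obtain ⟨S, hS, hsat⟩ := h𝒞.exists_saturating hκ
  obtain ⟨A, hA₀A, hA, hcl⟩ := exists_closed_superset hκ hA₀ (fun B => ⋃ x ∈ B, S x) fun B hB =>
    mk_biUnion_le_of_le (aleph0_le_two_power hκ) (hB.trans (cantor κ).le) fun x _ => hS x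
  refine ⟨A, hA₀A, hA, hsat A fun x hx => ?_⟩
  have := hcl {x} (Set.singleton_subset_iff.2 hx)
    (by rw [mk_singleton]; exact one_le_aleph0.trans hκ)
  simpa using this

/-! ### Free sequences and small `G_κ`-sets -/

/-- In a compact space, no sequence of length `κ⁺` is free, if the closure of the increasing sets
`H i` that contain its members is exhausted by the closures of sets of size at most `κ`. -/
theorem false_of_free_sequence [CompactSpace X] {I : Type u} [LinearOrder I]
    (hI : ∀ S : Set I, #S ≤ κ → ∃ i, ∀ s ∈ S, s < i) {H G : I → Set X} {x : I → X}
    (hκ : ℵ₀ ≤ κ) (hG : ∀ i, IsClosed (G i)) (hH : Monotone H)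
    (hsmall : ∀ z ∈ closure (⋃ i, H i), ∃ B ⊆ ⋃ i, H i, #B ≤ κ ∧ z ∈ closure B)
    (hxG : ∀ i j, i < j → x j ∈ G i) (hxH : ∀ i, x i ∈ ⋃ i, H i)
    (hdisj : ∀ i, Disjoint (closure (H i)) (G i)) : False := by
  have hne : Nonempty I := ⟨(hI ∅ (by simp)).choose⟩
  have hlt : ∀ i : I, ∃ j, i < j := fun i => by
    obtain ⟨j, hj⟩ := hI {i} (by rw [mk_singleton]; exact one_le_aleph0.trans hκ)
    exact ⟨j, hj i rfl⟩
  -- A point `z` in the closure of every tail. It lies in every `G i`, yet `hsmall` puts it in the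
  -- closure of a single `H i`.
  obtain ⟨z, hz⟩ : (⋂ i, closure (x '' Set.Ioi i)).Nonempty := by
    refine IsCompact.nonempty_iInter_of_directed_nonempty_isCompact_isClosed _ ?_ (fun i => ?_)
      (fun i => isClosed_closure.isCompact) fun i => isClosed_closure
    · exact directed_of_isDirected_le fun i j hij =>
        closure_mono (Set.image_mono (Set.Ioi_subset_Ioi hij))
    · obtain ⟨j, hj⟩ := hlt i
      exact ⟨x j, subset_closure ⟨j, hj, rfl⟩⟩
  rw [Set.mem_iInter] at hz
  have hzH : z ∈ closure (⋃ i, H i) := by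
    refine closure_mono ?_ (hz hne.some)
    rintro _ ⟨j, -, rfl⟩
    exact hxH j
  obtain ⟨B, hBH, hB, hzB⟩ := hsmall z hzH
  have hBH' : ∀ b : B, ∃ i, (b : X) ∈ H i := fun b => Set.mem_iUnion.1 (hBH b.2)
  choose c hc using hBH'
  obtain ⟨i, hi⟩ := hI (Set.range c) (mk_range_le.trans hB)
  have hBi : B ⊆ H i := fun b hb => hH (hi _ ⟨⟨b, hb⟩, rfl⟩).le (hc ⟨b, hb⟩)
  refine Set.disjoint_left.1 (hdisj i) (closure_mono hBi hzB) (closure_minimal ?_ (hG i) (hz i))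
  rintro _ ⟨j, hj, rfl⟩
  exact hxG i j hj

/-- Some non-empty common zero set of at most `κ` continuous functions lies in the closure of a set
of size at most `2 ^ κ`. -/
theorem IsWeakTightCover.exists_zeroSet_subset_closure [CompactSpace X] [T2Space X] [Nonempty X]
    {𝒞 : Set (Set X)} (hκ : ℵ₀ ≤ κ) (h𝒞 : IsWeakTightCover κ 𝒞) :
    ∃ 𝓕 : Set C(X, ℝ), #𝓕 ≤ κ ∧ (∃ p, ∀ f ∈ 𝓕, f p = 0) ∧
      ∃ H : Set X, #H ≤ 2 ^ κ ∧ ∀ x, (∀ f ∈ 𝓕, f x = 0) → x ∈ closure H := by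
  by_contra! hcon
  have h2 := aleph0_le_two_power hκ
  obtain ⟨I, _, _, hIio, hI⟩ := exists_wellOrder_succ hκ
  have hne : Nonempty I := ⟨(hI ∅ (by simp)).choose⟩
  have hκ2 : κ ≤ 2 ^ κ := (cantor κ).le
  -- A triple is a point, a function and a saturated set. The point is a zero of its own and all
  -- earlier functions; the set absorbs all earlier points and sets, and the function is `1` on its
  -- closure.
  let R : (i : I) → (Set.Iio i → X × C(X, ℝ) × Set X) → X × C(X, ℝ) × Set X → Prop := fun i g a =>
    (∀ j : Set.Iio i, (g j).2.2 ⊆ a.2.2 ∧ (g j).1 ∈ a.2.2 ∧ (g j).2.1 a.1 = 0) ∧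
      #a.2.2 ≤ 2 ^ κ ∧ IsSaturated 𝒞 a.2.2 ∧ a.2.1 a.1 = 0 ∧ ∀ y ∈ closure a.2.2, a.2.1 y = 1
  obtain ⟨g, hg⟩ : ∃ g : I → X × C(X, ℝ) × Set X, ∀ i, R i (fun k => g k) (g i) := by
    refine exists_forall_of_wellFounded R fun i g hg => ?_
    obtain ⟨H, hH₀, hHκ, hH⟩ := h𝒞.exists_isSaturated_superset hκ
      (A₀ := ⋃ j ∈ Set.Iio i, ((g j).2.2 ∪ {(g j).1}))
      (mk_biUnion_le_of_le h2 ((hIio i).trans hκ2) fun j hj =>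
        mk_union_le_of_le h2 (hg j hj).2.1 (by rw [mk_singleton]; exact one_le_aleph0.trans h2))
    have hzero : ∃ p, ∀ f ∈ (fun j => (g j).2.1) '' Set.Iio i, f p = 0 := by
      have : (⋂ j : Set.Iio i, {p | (g j).2.1 p = 0}).Nonempty := by
        refine CompactSpace.iInter_nonempty
          (fun j => isClosed_eq (g j).2.1.continuous continuous_const) fun s => ?_
        -- Among finitely many stages, the point of the last one is a common zero.
        rcases s.eq_empty_or_nonempty with rfl | hs
        · simp
        · refine ⟨(g (s.max' hs)).1, Set.mem_iInter₂.2 fun j hj => ?_⟩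
          rcases (s.le_max' j hj).eq_or_lt with h | h
          · rw [h]
            exact (hg _ (s.max' hs).2).2.2.2.1
          · exact ((hg _ (s.max' hs).2).1 ⟨j, h⟩).2.2
      obtain ⟨p, hp⟩ := this
      refine ⟨p, ?_⟩
      rintro _ ⟨j, hj, rfl⟩
      exact Set.mem_iInter.1 hp ⟨j, hj⟩
    obtain ⟨x, hx, hxH⟩ := hcon _ (mk_image_le.trans (hIio i)) hzero H hHκ
    obtain ⟨f, hf0, hf1, -⟩ := exists_continuous_zero_one_of_isClosed (isClosed_singleton (x := x))
      (isClosed_closure (s := H)) (Set.disjoint_singleton_left.2 hxH)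
    refine ⟨(x, f, H), fun j => ?_, hHκ, hH, hf0 rfl, fun y hy => hf1 hy⟩
    have hj := (Set.subset_biUnion_of_mem (u := fun j => (g j).2.2 ∪ {(g j).1}) j.2).trans hH₀
    exact ⟨Set.subset_union_left.trans hj, hj (Or.inr rfl), hx _ ⟨j, j.2, rfl⟩⟩
  refine false_of_free_sequence (H := fun i => (g i).2.2) (G := fun i => {y | (g i).2.1 y = 0})
    (x := fun i => (g i).1) hI hκ
    (fun i => isClosed_eq (g i).2.1.continuous continuous_const) (fun i j hij => ?_)
    (fun z hz => h𝒞.exists_subset_of_mem_closure (IsSaturated.iUnion fun i => (hg i).2.2.1) hz)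
    (fun i j hij => ((hg j).1 ⟨i, hij⟩).2.2) (fun i => ?_) (fun i => ?_)
  · rcases hij.eq_or_lt with rfl | hij
    · exact le_rfl
    · exact ((hg j).1 ⟨i, hij⟩).1
  · obtain ⟨j, hj⟩ := hI {i} (by rw [mk_singleton]; exact one_le_aleph0.trans hκ)
    exact Set.mem_iUnion.2 ⟨j, ((hg j).1 ⟨i, hj i rfl⟩).2.1⟩
  · refine Set.disjoint_left.2 fun y hy (hy' : (g i).2.1 y = 0) => ?_
    rw [(hg i).2.2.2.2 y hy] at hy'
    exact one_ne_zero hy'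

/-! ### Covers by `G_κ`-sets -/

/-- If every point is given a `G_κ`-set around it, then at most `2 ^ κ` of these sets cover the
space. -/
theorem IsWeakTightCover.exists_subcover [CompactSpace X] [T2Space X]
    {𝒞 : Set (Set X)} (hκ : ℵ₀ ≤ κ) (h𝒞 : IsWeakTightCover κ 𝒞) {K : Type u} (hK : #K = κ)
    (U : X → K → Set X) (hU : ∀ x k, IsOpen (U x k)) (hxU : ∀ x k, x ∈ U x k) :
    ∃ A : Set X, #A ≤ 2 ^ κ ∧ ∀ z, ∃ x ∈ A, ∀ k, z ∈ U x k := by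
  classical
  rcases isEmpty_or_nonempty X with hX | hX
  · exact ⟨∅, by simp, fun z => isEmptyElim z⟩
  have h2 := aleph0_le_two_power hκ
  have hκ2 : κ ≤ 2 ^ κ := (cantor κ).le
  obtain ⟨S, hS, hsat⟩ := h𝒞.exists_saturating hκ
  have hg : ∀ σ : K → Set X, ∃ x, (∃ x', ∀ k, (⋂ l, closure (σ l)) ⊆ U x' k) →
      ∀ k, (⋂ l, closure (σ l)) ⊆ U x k := fun σ => by
    by_cases h : ∃ x', ∀ k, (⋂ l, closure (σ l)) ⊆ U x' k
    · exact ⟨h.choose, fun _ => h.choose_spec⟩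
    · exact ⟨hX.some, fun h' => (h h').elim⟩
  choose g hg using hg
  have hz : ∀ s : Finset (X × K), ∃ z, (⋃ p ∈ s, U p.1 p.2) ≠ Set.univ →
      z ∉ ⋃ p ∈ s, U p.1 p.2 := fun s => by
    by_cases h : (⋃ p ∈ s, U p.1 p.2) = Set.univ
    · exact ⟨hX.some, fun h' => (h' h).elim⟩
    · obtain ⟨z, hz⟩ := (Set.ne_univ_iff_exists_notMem _).1 h
      exact ⟨z, fun _ => hz⟩
  choose z hz using hz
  -- Closing under `F` gives saturation, centres `g` for traces of small sets, and witnesses `z`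
  -- that finite families of the `U x k` do not cover.
  let F : Set X → Set X := fun B => (⋃ x ∈ B, S x) ∪
    (Set.range (fun σ : K → Set B => g fun k => (↑) '' σ k) ∪
      Set.range fun s : Finset (B × K) => z (s.image fun p => ((p.1 : X), p.2)))
  have hF : ∀ B : Set X, #B ≤ κ → #(F B) ≤ 2 ^ κ := fun B hB => by
    refine mk_union_le_of_le h2 (mk_biUnion_le_of_le h2 (hB.trans hκ2) fun x _ => hS x)
      (mk_union_le_of_le h2 (mk_range_le.trans ?_) (mk_range_le.trans ?_))
    · rw [← power_def, mk_set, hK]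
      exact (power_le_power_right (power_le_power_left two_ne_zero hB)).trans
        (two_power_power hκ).le
    · refine (mk_finset_le_of_le hκ ?_).trans hκ2
      rw [mk_prod, lift_id, lift_id]
      exact mul_le_of_le hκ hB hK.le
  obtain ⟨A, -, hA, hcl⟩ := exists_closed_superset hκ (A₀ := (∅ : Set X)) (by simp) F hF
  have hAsat : IsSaturated 𝒞 A := hsat A fun x hx => by
    have h := hcl {x} (Set.singleton_subset_iff.2 hx)
      (by rw [mk_singleton]; exact one_le_aleph0.trans hκ)
    have h' := Set.subset_union_left.trans h
    simpa using h'
  refine ⟨A, hA, ?_⟩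
  by_contra! hcon
  obtain ⟨q, hq⟩ := hcon
  have hcov : ∀ y ∈ closure A, ∃ p : X × K, p.1 ∈ A ∧ y ∈ U p.1 p.2 ∧ q ∉ U p.1 p.2 := by
    intro y hy
    obtain ⟨B, hBA, hB, hyB⟩ := h𝒞.exists_subset_of_mem_closure hAsat hy
    have hW : ∀ k, ∃ W, IsOpen W ∧ y ∈ W ∧ closure W ⊆ U y k := fun k => by
      obtain ⟨W, hW, hWo, hWU⟩ := exists_mem_nhds_isClosed_subset ((hU y k).mem_nhds (hxU y k))
      exact ⟨interior W, isOpen_interior, mem_interior_iff_mem_nhds.2 hW,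
        (closure_minimal interior_subset hWo).trans hWU⟩
    choose W hWo hyW hWU using hW
    -- The traces `B ∩ W k` all have `y` in their closures, and `y` itself is a centre for them. So
    -- `g` finds a centre in `A`, one of whose sets omits `q` but still contains `y`.
    let σ : K → Set B := fun k => (↑) ⁻¹' W k
    have hσ : ∀ k, ((↑) '' σ k : Set X) = B ∩ W k := fun k => Subtype.image_preimage_coe _ _
    have hmem : g (fun k => (↑) '' σ k) ∈ A := hcl B hBA hB (Or.inr (Or.inl ⟨σ, rfl⟩))
    have hgσ := hg (fun k => (↑) '' σ k) ⟨y, fun k => (Set.iInter_subset _ k).trans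
      ((closure_mono (by rw [hσ k]; exact Set.inter_subset_right)).trans (hWU k))⟩
    obtain ⟨k, hk⟩ := hq _ hmem
    refine ⟨(_, k), hmem, hgσ k (Set.mem_iInter.2 fun l => ?_), hk⟩
    rw [hσ l, Set.inter_comm]
    exact (hWo l).inter_closure ⟨hyW l, hyB⟩
  have hKne : Nonempty K := mk_ne_zero_iff.1 (hK ▸ (aleph0_pos.trans_le hκ).ne')
  choose! P hPA hP hqP using hcov
  obtain ⟨t, ht, htc⟩ := (isClosed_closure (s := A)).isCompact.elim_nhds_subcover
    (fun y => U (P y).1 (P y).2) fun y hy => (hU _ _).mem_nhds (hP y hy)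
  let B : Set X := (fun y => (P y).1) '' t
  have hBA : B ⊆ A := by
    rintro _ ⟨y, hy, rfl⟩
    exact hPA y (ht y hy)
  have hB : #B ≤ κ := ((t.finite_toSet.image _).lt_aleph0).le.trans hκ
  let s : Finset (B × K) := t.attach.image fun y => (⟨(P y.1).1, y.1, y.2, rfl⟩, (P y.1).2)
  have hmem : z (s.image fun p => ((p.1 : X), p.2)) ∈ A :=
    hcl B hBA hB (Or.inr (Or.inr ⟨s, rfl⟩))
  have hs : (⋃ p ∈ s.image fun p => ((p.1 : X), p.2), U p.1 p.2) = ⋃ y ∈ t, U (P y).1 (P y).2 := by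
    have hst : s.image (fun p => ((p.1 : X), p.2)) = t.image P := by
      rw [Finset.image_image]
      change t.attach.image (P ∘ Subtype.val) = _
      rw [← Finset.image_image, Finset.attach_image_val]
    rw [hst, Finset.set_biUnion_finset_image]
  have hz' := hz (s.image fun p => ((p.1 : X), p.2))
  rw [hs] at hz'
  refine hz' ?_ (htc (subset_closure hmem))
  refine (Set.ne_univ_iff_exists_notMem _).2 ⟨q, fun hqt => ?_⟩
  obtain ⟨y, hy, hqy⟩ := Set.mem_iUnion₂.1 hqt
  exact hqP y (ht y hy) hqy

/-! ### Homogeneity and the cardinality bound -/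

/-- In a homogeneous Hausdorff space, a dense set and a local `π`-base bound the cardinality. -/
theorem IsHomogeneous.card_le_of_dense [T2Space X] (hX : IsHomogeneous X) {D : Set X}
    (hD : Dense D) {p : X} {𝓑 : Set (Set X)} (h𝓑 : IsLocalPiBase p 𝓑) : #X ≤ #D ^ #𝓑 := by
  choose h hh using hX p
  have hd : ∀ (x : X) (V : 𝓑), ∃ d : D, (d : X) ∈ h x '' V := fun x V => by
    obtain ⟨d, hd, hdD⟩ := hD.inter_open_nonempty _
      ((h x).isOpenMap _ (h𝓑.1 V V.2).1) ((h𝓑.1 V V.2).2.image _)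
    exact ⟨⟨d, hdD⟩, hd⟩
  choose d hd using hd
  rw [power_def]
  refine mk_le_of_injective (f := d) fun x y hxy => ?_
  by_contra hne
  obtain ⟨U, W, hU, hW, hxU, hyW, hUW⟩ := t2_separation hne
  obtain ⟨V, hV, hVUW⟩ := h𝓑.2 (h x ⁻¹' U ∩ h y ⁻¹' W) (Filter.inter_mem
    ((h x).continuous.continuousAt.preimage_mem_nhds (by rw [hh]; exact hU.mem_nhds hxU))
    ((h y).continuous.continuousAt.preimage_mem_nhds (by rw [hh]; exact hW.mem_nhds hyW)))
  obtain ⟨v, hv, hvd⟩ := hd x ⟨V, hV⟩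
  obtain ⟨w, hw, hwd⟩ := hd y ⟨V, hV⟩
  refine Set.disjoint_left.1 hUW (hVUW hv).1 ?_
  rw [hvd, hxy, ← hwd]
  exact (hVUW hw).2

theorem IsWeakTightCover.exists_dense [CompactSpace X] [T2Space X] {𝒞 : Set (Set X)} (hκ : ℵ₀ ≤ κ)
    (h𝒞 : IsWeakTightCover κ 𝒞) (hX : IsHomogeneous X) :
    ∃ D : Set X, Dense D ∧ #D ≤ 2 ^ κ := by
  rcases isEmpty_or_nonempty X with hE | hE
  · exact ⟨∅, fun x => isEmptyElim x, by simp⟩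
  have h2 := aleph0_le_two_power hκ
  obtain ⟨𝓕, h𝓕, ⟨p, hp⟩, H, hHκ, hH⟩ := h𝒞.exists_zeroSet_subset_closure hκ
  let K : Type u := κ.out
  have hK : #K = κ := mk_out κ
  -- The bounds `|f| < 1 / (n + 1)` write the zero set as a `G_κ`-set. Inserting `0` keeps the
  -- family non-empty so that `K` can enumerate it.
  obtain ⟨e, he⟩ := exists_range_eq (κ := κ) (S := (insert 0 𝓕 ×ˢ Set.univ : Set (C(X, ℝ) × ULift ℕ)))
    (by
      rw [mk_setProd]
      refine mul_le_of_le hκ ?_ ?_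
      · exact mk_insert_le.trans (add_le_of_le hκ h𝓕 (one_le_aleph0.trans hκ))
      · simpa using hκ)
    ⟨(0, ⟨0⟩), Set.mem_insert _ _, trivial⟩ hK
  choose h hh using fun x => hX x p
  have hz : ∀ f ∈ insert 0 𝓕, f p = 0 := by
    rintro f (rfl | hf)
    · rfl
    · exact hp f hf
  obtain ⟨A, hA, hcov⟩ := h𝒞.exists_subcover hκ hK
    (fun x k => {y | |(e k).1 (h x y)| < 1 / ((e k).2.down + 1 : ℝ)})
    (fun x k => isOpen_lt (by fun_prop) continuous_const) (fun x k => by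
      have hk : e k ∈ insert 0 𝓕 ×ˢ Set.univ := he ▸ Set.mem_range_self k
      change |(e k).1 (h x x)| < _
      rw [hh, hz _ hk.1, abs_zero]
      positivity)
  refine ⟨⋃ x ∈ A, (h x).symm '' H, fun y => ?_, mk_biUnion_le_of_le h2 hA fun x _ =>
    mk_image_le.trans hHκ⟩
  obtain ⟨x, hx, hy⟩ := hcov y
  have hyH : h x y ∈ closure H := hH _ fun f hf => by
    by_contra hne
    obtain ⟨n, hn⟩ := exists_nat_one_div_lt (abs_pos.2 hne)
    obtain ⟨k, hk⟩ : (f, (⟨n⟩ : ULift ℕ)) ∈ Set.range e :=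
      he ▸ ⟨Set.mem_insert_of_mem _ hf, trivial⟩
    have h3 := hy k
    rw [Set.mem_ofPred_eq, hk] at h3
    exact lt_asymm hn h3
  refine closure_mono (Set.subset_biUnion_of_mem (u := fun x => (h x).symm '' H) hx) ?_
  rw [← (h x).symm.image_closure]
  exact ⟨_, hyH, (h x).symm_apply_apply y⟩

theorem IsHomogeneous.card_le [CompactSpace X] [T2Space X] (hX : IsHomogeneous X) :
    #X ≤ 2 ^ (weakTightness X * piCharacter X) := by
  rcases isEmpty_or_nonempty X with hE | ⟨⟨p⟩⟩
  · simp
  obtain ⟨hw, 𝒞, h𝒞⟩ := exists_isWeakTightCover X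
  obtain ⟨hπ, h⟩ := piCharacter_mem X
  obtain ⟨𝓑, h𝓑, hcard⟩ := h p
  have hwκ : weakTightness X ≤ weakTightness X * piCharacter X :=
    le_mul_right (aleph0_pos.trans_le hπ).ne'
  have hπκ : piCharacter X ≤ weakTightness X * piCharacter X :=
    le_mul_left (aleph0_pos.trans_le hw).ne'
  obtain ⟨D, hD, hDκ⟩ := (h𝒞.mono hwκ).exists_dense (hw.trans hwκ) hX
  calc #X ≤ #D ^ #𝓑 := hX.card_le_of_dense hD h𝓑
    _ ≤ (2 ^ (weakTightness X * piCharacter X)) ^ #𝓑 := power_le_power_right hDκ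
    _ ≤ (2 ^ (weakTightness X * piCharacter X)) ^ (weakTightness X * piCharacter X) :=
      power_le_power_left (power_ne_zero _ two_ne_zero) (hcard.trans hπκ)
    _ = 2 ^ (weakTightness X * piCharacter X) := two_power_power (hw.trans hwκ)

/-! ### The `π`-character and the tightness -/

/-- Šapirovskiĭ's inequality between the `π`-character and the tightness of a compactum. -/
theorem piCharacter_le_tightness [CompactSpace X] [T2Space X] : piCharacter X ≤ tightness X := by
  classical
  obtain ⟨hκ, ht⟩ := tightness_mem X
  refine csInf_le' ⟨hκ, fun p => ?_⟩
  by_contra! hcon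
  obtain ⟨I, _, _, hIio, hI⟩ := exists_wellOrder_succ hκ
  let O : (I → Set X × Set X) → Finset I → Finset I → Set X := fun g s t =>
    (⋂ j ∈ s, (g j).2) ∩ ⋂ j ∈ t, (closure (g j).1)ᶜ
  have hO : ∀ g s t, (∀ j ∈ s, IsOpen (g j).2) → IsOpen (O g s t) := fun g s t hs =>
    (isOpen_biInter_finset hs).inter (isOpen_biInter_finset fun j _ => isClosed_closure.isOpen_compl)
  -- The sets `O g s t` from earlier stages, when non-empty, number at most `t(X)`, so they form no
  -- local `π`-base at `p`: some neighbourhood of `p` includes none of them.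
  let Q : I → (I → Set X × Set X) → Set X × Set X → Prop := fun i g a =>
    (IsOpen a.1 ∧ IsOpen a.2 ∧ p ∈ a.2 ∧ closure a.2 ⊆ a.1) ∧
      ∀ s t : Finset I, (∀ j ∈ s, j < i) → (∀ j ∈ t, j < i) → (O g s t).Nonempty →
        ¬ O g s t ⊆ closure a.1
  have hQ : ∀ i g g' a, (∀ j < i, g j = g' j) → Q i g a → Q i g' a := by
    intro i g g' a hgg h
    refine ⟨h.1, fun s t hs ht => ?_⟩
    have : O g' s t = O g s t := by
      simp only [O]
      rw [Set.iInter₂_congr fun j hj => by rw [← hgg j (hs j hj)],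
        Set.iInter₂_congr (s := fun j _ => (closure (g' j).1)ᶜ) fun j hj => by
          rw [← hgg j (ht j hj)]]
    rw [this]
    exact h.2 s t hs ht
  obtain ⟨g, hg⟩ : ∃ g : I → Set X × Set X, ∀ i, Q i g (g i) := by
    let R : (i : I) → (Set.Iio i → Set X × Set X) → Set X × Set X → Prop := fun i g a =>
      Q i (fun j => if hj : j < i then g ⟨j, hj⟩ else (∅, ∅)) a
    suffices h : ∃ g : I → Set X × Set X, ∀ i, R i (fun k => g k) (g i) by
      obtain ⟨g, hg⟩ := h
      exact ⟨g, fun i => hQ i _ _ _ (fun j hj => by simp [hj]) (hg i)⟩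
    refine exists_forall_of_wellFounded R fun i g hg => ?_
    suffices h : ∃ a, Q i g a from
      h.imp fun a ha => hQ i _ _ _ (fun j hj => by simp [hj]) ha
    let 𝓑 : Set (Set X) := {V | V.Nonempty} ∩
      Set.range fun st : Finset (Set.Iio i) × Finset (Set.Iio i) =>
        O g (st.1.map (Function.Embedding.subtype _)) (st.2.map (Function.Embedding.subtype _))
    have h𝓑 : #𝓑 ≤ tightness X := by
      refine (mk_le_mk_of_subset Set.inter_subset_right).trans (mk_range_le.trans ?_)
      rw [mk_prod]
      have := mk_finset_le_of_le hκ (hIio i)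
      simpa using mul_le_of_le hκ this this
    have hnot : ¬ IsLocalPiBase p 𝓑 := fun h => (hcon 𝓑 h).not_ge h𝓑
    have hopen : ∀ V ∈ 𝓑, IsOpen V ∧ V.Nonempty := by
      rintro _ ⟨hne, st, rfl⟩
      refine ⟨hO _ _ _ fun j hj => ?_, hne⟩
      obtain ⟨j', -, rfl⟩ := Finset.mem_map.1 hj
      exact (hg j' j'.2).1.2.1
    obtain ⟨U, hU, hUV⟩ : ∃ U ∈ 𝓝 p, ∀ V ∈ 𝓑, ¬ V ⊆ U := by
      by_contra! h
      exact hnot ⟨hopen, h⟩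
    obtain ⟨U₁, hU₁, hU₁c, hU₁U⟩ := exists_mem_nhds_isClosed_subset hU
    obtain ⟨V, hV, hVc, hVU⟩ := exists_mem_nhds_isClosed_subset (interior_mem_nhds.2 hU₁)
    refine ⟨(interior U₁, interior V), ⟨isOpen_interior, isOpen_interior,
      mem_interior_iff_mem_nhds.2 hV, (closure_minimal interior_subset hVc).trans hVU⟩,
      fun s t hs ht hne hsub => ?_⟩
    refine hUV (O g s t) ⟨hne, (s.subtype (· < i), t.subtype (· < i)), ?_⟩
      (hsub.trans ((closure_minimal interior_subset hU₁c).trans hU₁U))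
    have e1 : (s.subtype (· < i)).map (Function.Embedding.subtype _) = s :=
      Finset.subtype_map_of_mem hs
    have e2 : (t.subtype (· < i)).map (Function.Embedding.subtype _) = t :=
      Finset.subtype_map_of_mem ht
    change O g ((s.subtype (· < i)).map (Function.Embedding.subtype _))
      ((t.subtype (· < i)).map (Function.Embedding.subtype _)) = _
    rw [e1, e2]
  -- Starting from `p`, each new maximal index `b` of `t` is handled by `Q` at stage `b`, for which
  -- all of `s` and the rest of `t` are earlier.
  have hOne : ∀ t s : Finset I, (∀ a ∈ s, ∀ b ∈ t, a < b) → (O g s t).Nonempty := by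
    intro t
    induction t using Finset.induction_on_max with
    | empty =>
      intro s _
      exact ⟨p, Set.mem_iInter₂.2 fun j _ => (hg j).1.2.2.1, by simp⟩
    | insert b t hb ih =>
      intro s hs
      obtain ⟨y, hy, hyb⟩ := Set.not_subset.1 ((hg b).2 s t
        (fun j hj => hs j hj b (Finset.mem_insert_self _ _)) hb
        (ih s fun a ha c hc => hs a ha c (Finset.mem_insert_of_mem hc)))
      refine ⟨y, hy.1, Set.mem_iInter₂.2 fun j hj => ?_⟩
      rcases Finset.mem_insert.1 hj with rfl | hj
      · exact hyb
      · exact Set.mem_iInter₂.1 hy.2 j hj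
  -- The free sequence: `x i` lies in the inner closures of all stages before `i` and outside the
  -- outer sets from `i` on.
  have hx : ∀ i, ∃ x : X, ∀ j, x ∈ if j < i then closure (g j).2 else ((g j).1)ᶜ := by
    intro i
    have := CompactSpace.iInter_nonempty
      (t := fun j => if j < i then closure (g j).2 else ((g j).1)ᶜ) (fun j => by
        split_ifs
        · exact isClosed_closure
        · exact (hg j).1.1.isClosed_compl) (fun s => by
        obtain ⟨y, hy1, hy2⟩ := hOne (s.filter fun j => ¬ j < i) (s.filter (· < i))
          fun a ha b hb => (Finset.mem_filter.1 ha).2.trans_le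
            (not_lt.1 (Finset.mem_filter.1 hb).2)
        refine ⟨y, Set.mem_iInter₂.2 fun j hj => ?_⟩
        split_ifs with h
        · exact subset_closure (Set.mem_iInter₂.1 hy1 j (Finset.mem_filter.2 ⟨hj, h⟩))
        · exact fun hyj => Set.mem_iInter₂.1 hy2 j (Finset.mem_filter.2 ⟨hj, h⟩)
            (subset_closure hyj))
    exact this.imp fun x hx j => Set.mem_iInter.1 hx j
  choose x hx using hx
  refine false_of_free_sequence (H := fun i => x '' Set.Iic i) (G := fun i => closure (g i).2)
    (x := x) hI hκ (fun i => isClosed_closure)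
    (fun i j hij => Set.image_mono (Set.Iic_subset_Iic.2 hij)) (fun z hz => ht _ z hz)
    (fun i j hij => ?_) (fun i => Set.mem_iUnion.2 ⟨i, i, le_rfl, rfl⟩) (fun i => ?_)
  · have := hx j i
    rwa [if_pos hij] at this
  · refine (Set.disjoint_left.2 fun y hy hy' => ?_ : Disjoint _ ((g i).1)).mono_right (hg i).1.2.2.2
    refine closure_minimal (t := ((g i).1)ᶜ) ?_ (hg i).1.1.isClosed_compl hy hy'
    rintro _ ⟨j, hj, rfl⟩
    have := hx j i
    rwa [if_neg (not_lt.2 hj)] at this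

end

end CardFun

theorem corollary3p6 {X : Type u} [TopologicalSpace X] [CompactSpace X] [T2Space X] :
    (CardFun.IsHomogeneous X →
      #X ≤ 2 ^ (CardFun.weakTightness X * CardFun.piCharacter X)) ∧
    CardFun.weakTightness X ≤ CardFun.tightness X ∧
    CardFun.piCharacter X ≤ CardFun.tightness X ∧
    (CardFun.IsHomogeneous X → #X ≤ 2 ^ CardFun.tightness X) := by
  refine ⟨fun h => h.card_le, CardFun.weakTightness_le_tightness,
    CardFun.piCharacter_le_tightness, fun h => h.card_le.trans ?_⟩
  exact power_le_power_left two_ne_zero (mul_le_of_le (CardFun.tightness_mem X).1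
    CardFun.weakTightness_le_tightness CardFun.piCharacter_le_tightness)
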